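/- Let $H$ be a real Hilbert space, let $X\subset H$ be a non-convex sequentially weakly closed set (the weak limit of every weakly convergent sequence of points of $X$ belongs to $X$), and let $u_0\in\operatorname{conv}(X)\setminus X$. Put $\delta:=\operatorname{dist}(u_0,X)=\inf_{x\in X}\|u_0-x\|$ (which is positive) and, for each $r>0$, $$\rho_r:=\sup_{\|y\|<r}\left(\operatorname{dist}(u_0+y,X)^2-\|y\|^2\right).$$ Then, for every convex set $S\subseteq H$ dense in $H$, for every bounded sequentially weakly lower semicontinuous function $\varphi:X\to\mathbb{R}$ (that is, $\varphi(x)\le\liminf_{n\to\infty}\varphi(x_n)$ whenever $x_n,x\in X$ and $x_n$ converges weakly to $x$), and for every $r>0$ satisfying $$r>\frac{\rho_r-\delta^2+\sup_X\varphi-\inf_X\varphi}{2\delta},$$ there exists $y_0\in S$ with $\|y_0-u_0\|<r$ such that the function $x\mapsto\|x-y_0\|^2+\varphi(x)$ has at least two global minima in $X$, i.e. there are two distinct points of $X$ at which it attains its infimum over $X$. -/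

import Mathlib

open Filter Topology

/-- `u n ⇀ x`: convergence of the sequence `u` to `x` in the weak topology of `H`. -/
def WeakTendsto {H : Type*} [NormedAddCommGroup H] [InnerProductSpace ℝ H]
    (u : ℕ → H) (x : H) : Prop :=
  Tendsto (fun n => toWeakSpace ℝ H (u n)) atTop (𝓝 (toWeakSpace ℝ H x))

/-- `X` contains the weak limits of all weakly convergent sequences of its points. -/
def SeqWeaklyClosed {H : Type*} [NormedAddCommGroup H] [InnerProductSpace ℝ H]
    (X : Set H) : Prop :=
  ∀ (u : ℕ → H) (x : H), (∀ n, u n ∈ X) → WeakTendsto u x → x ∈ X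

/-- `φ x ≤ liminf φ (u n)` whenever `u n ⇀ x` with all `u n` and `x` in `X`; the inequality is
written in its order form: every `c < φ x` satisfies `c < φ (u n)` for all large `n`. -/
def SeqWeaklyLSC {H : Type*} [NormedAddCommGroup H] [InnerProductSpace ℝ H]
    {X : Set H} (φ : X → ℝ) : Prop :=
  ∀ (u : ℕ → X) (x : X), WeakTendsto (fun n => (u n : H)) (x : H) →
    ∀ c : ℝ, c < φ x → ∀ᶠ n in atTop, c < φ (u n)

/-- `ρ_r = sup_{‖y‖ < r} (dist(u₀ + y, X)² - ‖y‖²)`. -/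
noncomputable def rho {H : Type*} [NormedAddCommGroup H] [InnerProductSpace ℝ H]
    (X : Set H) (u₀ : H) (r : ℝ) : ℝ :=
  sSup ((fun y : H => Metric.infDist (u₀ + y) X ^ 2 - ‖y‖ ^ 2) '' {y : H | ‖y‖ < r})

/-- The supremum defining `rho` is that of a set bounded above. -/
theorem rho_bddAbove {H : Type*} [NormedAddCommGroup H] [InnerProductSpace ℝ H]
    (X : Set H) (u₀ : H) (r : ℝ) :
    BddAbove ((fun y : H => Metric.infDist (u₀ + y) X ^ 2 - ‖y‖ ^ 2) '' {y : H | ‖y‖ < r}) := by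
  refine ⟨(Metric.infDist u₀ X + r) ^ 2, ?_⟩
  rintro _ ⟨y, hy, rfl⟩
  have h1 : Metric.infDist (u₀ + y) X ≤ Metric.infDist u₀ X + ‖y‖ := by
    have := Metric.infDist_le_infDist_add_dist (s := X) (x := u₀ + y) (y := u₀)
    simpa [dist_eq_norm] using this
  have h2 : 0 ≤ Metric.infDist (u₀ + y) X := Metric.infDist_nonneg
  have h3 : ‖y‖ < r := hy
  have h4 : Metric.infDist (u₀ + y) X ^ 2 ≤ (Metric.infDist u₀ X + r) ^ 2 :=
    pow_le_pow_left₀ h2 (by linarith) 2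
  have h5 := sq_nonneg ‖y‖
  show Metric.infDist (u₀ + y) X ^ 2 - ‖y‖ ^ 2 ≤ _
  linarith

/-- The distance of an outside point to a nonempty sequentially weakly closed set is positive. -/
theorem SeqWeaklyClosed.infDist_pos {H : Type*} [NormedAddCommGroup H] [InnerProductSpace ℝ H]
    {X : Set H} (hX : SeqWeaklyClosed X) (hne : X.Nonempty) {u₀ : H} (hu : u₀ ∉ X) :
    0 < Metric.infDist u₀ X := by
  have hc : IsClosed X := by
    refine IsSeqClosed.isClosed fun u x hu hx => hX u x hu ?_
    exact ((toWeakSpaceCLM ℝ H).continuous.tendsto x).comp hx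
  exact (hc.notMem_iff_infDist_pos hne).1 hu

/-!
For `x ∈ X` and `y ∈ S ∩ B(u₀, r)` put `f x y = ‖x - y‖² + φ x - ‖y - u₀‖²`. Subtracting
`‖y - u₀‖²` does not change the minimizers in `x`, and it makes `f` affine in `y`. On one side,
`inf_x f x y ≤ dist(y, X)² - ‖y - u₀‖² + sup φ ≤ ρ_r + sup φ` for every `y`. On the other side,
letting `y` approach the boundary point of the ball opposite to `x` gives
`sup_y f x y ≥ ‖x - u₀‖² + 2 r ‖x - u₀‖ + φ x ≥ δ² + 2 r δ + inf φ`; density of `S` is enough here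
because the ball is open (`exists_mem_dense_lt_norm_sq_sub`). The assumption on `r` therefore says
that `sup_y inf_x f < inf_x sup_y f`.

Such a gap forces two global minimizers of `f · y` for some `y` (`exists_two_minimizers`). By
compactness of the sublevel sets the gap persists for a finite set of points `y`, and on the simplex
they span the concave function `y ↦ inf_x f x y` attains its maximum `M`. If the minimizer there is
unique, then a comparison with the minimizers for nearby `y` shows that `f` is at most `M` at this
minimizer for all `y` in the simplex, so that there is no gap
(`exists_forall_le_of_unique_min`).

The sublevel sets of `f · y` are bounded and sequentially weakly closed
(`seqWeaklyClosed_sublevel`). They are weakly compact by the Banach–Alaoglu theorem and the fact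
that weak closure points of bounded sets in a Hilbert space are limits of sequences
(`exists_seq_weakTendsto_of_mem_closure`).
-/

/-! ### Weak convergence and weak compactness in a Hilbert space -/

theorem weakTendsto_iff_inner {H : Type*} [NormedAddCommGroup H] [InnerProductSpace ℝ H]
    [CompleteSpace H] {u : ℕ → H} {x : H} :
    WeakTendsto u x ↔ ∀ e, Tendsto (fun n => inner ℝ e (u n)) atTop (𝓝 (inner ℝ e x)) := by
  have h : WeakTendsto u x ↔
      ∀ g : StrongDual ℝ H, Tendsto (fun n => g (u n)) atTop (𝓝 (g x)) := by
    refine WeakBilin.tendsto_iff_forall_eval_tendsto (topDualPairing ℝ H).flip ?_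
    intro a b hab
    refine ext_inner_left ℝ fun v => ?_
    exact DFunLike.congr_fun hab (innerSL ℝ v)
  rw [h]
  refine ⟨fun hg e => hg (innerSL ℝ e), fun he g => ?_⟩
  simpa using he ((InnerProductSpace.toDual ℝ H).symm g)

/-- The Riesz representation as a bijection of a Hilbert space onto its weak-* dual. The topology
it induces on `H` is the weak topology. -/
noncomputable def rieszWeakDual (H : Type*) [NormedAddCommGroup H] [InnerProductSpace ℝ H]
    [CompleteSpace H] (x : H) : WeakDual ℝ H :=
  StrongDual.toWeakDual (InnerProductSpace.toDual ℝ H x)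

theorem rieszWeakDual_apply {H : Type*} [NormedAddCommGroup H] [InnerProductSpace ℝ H]
    [CompleteSpace H] (x e : H) : rieszWeakDual H x e = inner ℝ x e := rfl

theorem rieszWeakDual_bijective (H : Type*) [NormedAddCommGroup H] [InnerProductSpace ℝ H]
    [CompleteSpace H] : Function.Bijective (rieszWeakDual H) :=
  (StrongDual.toWeakDual (𝕜 := ℝ) (E := H)).bijective.comp
    (InnerProductSpace.toDual ℝ H).bijective

/-- The vectors `e` along which `⟪e, a n - q⟫ → 0` form a closed subspace when `a` is bounded. If
that subspace contains `q` and all `a n`, it contains their closed span, and on the orthogonal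
complement of the span `⟪e, a n - q⟫` vanishes. -/
theorem weakTendsto_of_inner_self_tendsto {H : Type*} [NormedAddCommGroup H]
    [InnerProductSpace ℝ H] [CompleteSpace H] {a : ℕ → H} {q : H} {R : ℝ}
    (hR : ∀ n, ‖a n - q‖ ≤ R)
    (hq : Tendsto (fun n => inner ℝ q (a n - q)) atTop (𝓝 0))
    (ha : ∀ k, Tendsto (fun n => inner ℝ (a k) (a n - q)) atTop (𝓝 0)) :
    WeakTendsto a q := by
  have hR0 : 0 ≤ R := (norm_nonneg _).trans (hR 0)
  let V : Submodule ℝ H := Submodule.span ℝ (insert q (Set.range a))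
  have hV : ∀ e ∈ V, Tendsto (fun n => inner ℝ e (a n - q)) atTop (𝓝 0) := by
    intro e he
    induction he using Submodule.span_induction with
    | mem x hx =>
      rcases hx with rfl | ⟨k, rfl⟩
      · exact hq
      · exact ha k
    | zero => simp
    | add x y _ _ hx hy => simpa [inner_add_left] using hx.add hy
    | smul c x _ hx => simpa [inner_smul_left] using hx.const_mul c
  have hVc : ∀ e ∈ V.topologicalClosure, Tendsto (fun n => inner ℝ e (a n - q)) atTop (𝓝 0) := by
    intro e he
    rw [Metric.tendsto_atTop]
    intro ε hε
    obtain ⟨v, hv, hev⟩ := Metric.mem_closure_iff.1 he (ε / (2 * (R + 1))) (by positivity)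
    obtain ⟨N, hN⟩ := Metric.tendsto_atTop.1 (hV v hv) (ε / 2) (by positivity)
    refine ⟨N, fun n hn => ?_⟩
    have h1 := hN n hn
    rw [Real.dist_eq, sub_zero] at h1 ⊢
    have h2 : |inner ℝ (e - v) (a n - q)| ≤ ‖e - v‖ * R :=
      (abs_real_inner_le_norm _ _).trans (by gcongr; exact hR n)
    have h3 : ‖e - v‖ * R ≤ ε / 2 := by
      rw [dist_eq_norm] at hev
      calc ‖e - v‖ * R ≤ ε / (2 * (R + 1)) * (R + 1) := by gcongr; linarith
        _ = ε / 2 := by field_simp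
    have h4 : (inner ℝ e (a n - q) : ℝ) = inner ℝ (e - v) (a n - q) + inner ℝ v (a n - q) := by
      rw [← inner_add_left]; simp
    rw [h4]
    exact (abs_add_le _ _).trans_lt (by linarith)
  have hcl : ∀ x ∈ V, x ∈ V.topologicalClosure := fun x hx => V.le_topologicalClosure hx
  have hall : ∀ e, Tendsto (fun n => inner ℝ e (a n - q)) atTop (𝓝 0) := by
    intro e
    have : CompleteSpace V.topologicalClosure :=
      V.isClosed_topologicalClosure.completeSpace_coe
    obtain ⟨v, hv, w, hw, rfl⟩ := V.topologicalClosure.exists_add_mem_mem_orthogonal e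
    have hw0 : ∀ n, (inner ℝ w (a n - q) : ℝ) = 0 := fun n => by
      refine Submodule.inner_left_of_mem_orthogonal ?_ hw
      refine V.topologicalClosure.sub_mem (hcl _ (Submodule.subset_span ?_))
        (hcl _ (Submodule.subset_span ?_))
      · exact Set.mem_insert_of_mem _ ⟨n, rfl⟩
      · exact Set.mem_insert _ _
    simpa [inner_add_left, hw0] using hVc v hv
  rw [weakTendsto_iff_inner]
  intro e
  have := (hall e).add_const (inner ℝ e q)
  simpa [inner_sub_right] using this

/-- Bounded sets of a Hilbert space are angelic for the weak topology: a weak closure point of `A`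
is the weak limit of a sequence in `A`. The sequence is chosen so that `a n - q` is almost
orthogonal to `q` and to all earlier terms. -/
theorem exists_seq_weakTendsto_of_mem_closure {H : Type*} [NormedAddCommGroup H]
    [InnerProductSpace ℝ H] [CompleteSpace H] {A : Set H} (hA : Bornology.IsBounded A) {q : H}
    (hq : rieszWeakDual H q ∈ closure (rieszWeakDual H '' A)) :
    ∃ a : ℕ → H, (∀ n, a n ∈ A) ∧ WeakTendsto a q := by
  have happrox : ∀ (s : Finset H) (ε : ℝ), 0 < ε →
      ∃ b ∈ A, ∀ e ∈ s, |inner ℝ e (b - q)| < ε := by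
    intro s ε hε
    have hopen : IsOpen {w : WeakDual ℝ H | ∀ e ∈ s, |w e - inner ℝ q e| < ε} := by
      have : {w : WeakDual ℝ H | ∀ e ∈ s, |w e - inner ℝ q e| < ε} =
          ⋂ e ∈ s, {w : WeakDual ℝ H | |w e - inner ℝ q e| < ε} := by ext; simp
      rw [this]
      refine isOpen_biInter_finset fun e _ => ?_
      exact isOpen_lt (((WeakDual.eval_continuous e).sub continuous_const).abs) continuous_const
    obtain ⟨_, hw, b, hb, rfl⟩ := mem_closure_iff.1 hq _ hopen
      (fun e _ => by simpa [rieszWeakDual_apply] using hε)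
    refine ⟨b, hb, fun e he => ?_⟩
    have := hw e he
    rwa [rieszWeakDual_apply, ← inner_sub_left, real_inner_comm] at this
  -- The first component records the accuracy `1 / (k + 1)`, which improves along the sequence.
  obtain ⟨f, hfA, hf⟩ := exists_seq_of_forall_finset_exists
    (fun z : ℕ × H => z.2 ∈ A ∧ |inner ℝ q (z.2 - q)| < 1 / ((z.1 : ℝ) + 1))
    (fun z z' => z.1 < z'.1 ∧ |inner ℝ z.2 (z'.2 - q)| < 1 / ((z'.1 : ℝ) + 1)) (by
      classical
      intro s _
      obtain ⟨b, hb, hbs⟩ := happrox (insert q (s.image Prod.snd))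
        (1 / (((s.sup Prod.fst + 1 : ℕ) : ℝ) + 1)) (by positivity)
      refine ⟨(s.sup Prod.fst + 1, b), ⟨hb, hbs q (by simp)⟩, fun z hz => ⟨?_, hbs _ ?_⟩⟩
      · exact Nat.lt_succ_of_le (Finset.le_sup (f := Prod.fst) hz)
      · exact Finset.mem_insert_of_mem (Finset.mem_image_of_mem _ hz))
  have hmono : StrictMono fun n => (f n).1 := fun m n hmn => (hf m n hmn).1
  have hlim : Tendsto (fun n => 1 / (((f n).1 : ℝ) + 1)) atTop (𝓝 0) :=
    tendsto_one_div_add_atTop_nhds_zero_nat.comp hmono.tendsto_atTop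
  obtain ⟨R, hR⟩ := hA.exists_norm_le
  refine ⟨fun n => (f n).2, fun n => (hfA n).1,
    weakTendsto_of_inner_self_tendsto (R := R + ‖q‖) (fun n => ?_) ?_ fun k => ?_⟩
  · exact (norm_sub_le _ _).trans (by gcongr; exact hR _ (hfA n).1)
  · exact squeeze_zero_norm (fun n => (hfA n).2.le) hlim
  · refine squeeze_zero_norm' ?_ hlim
    filter_upwards [eventually_gt_atTop k] with n hn
    exact (hf k n hn).2.le

/-- Bounded sequentially weakly closed sets are weakly compact (an Eberlein–Šmulian statement). -/
theorem SeqWeaklyClosed.isCompact_image {H : Type*} [NormedAddCommGroup H]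
    [InnerProductSpace ℝ H] [CompleteSpace H] {A : Set H} (hA : SeqWeaklyClosed A)
    (hb : Bornology.IsBounded A) : IsCompact (rieszWeakDual H '' A) := by
  apply WeakDual.isCompact_of_bounded_of_closed
  · rw [← WeakDual.isBounded_toWeakDual_preimage_iff_isBounded]
    refine ((InnerProductSpace.toDual ℝ H).lipschitz.isBounded_image hb).subset ?_
    rintro _ ⟨x, hx, h⟩
    exact ⟨x, hx, h⟩
  · refine isClosed_of_closure_subset fun p hp => ?_
    obtain ⟨q, rfl⟩ := (rieszWeakDual_bijective H).2 p
    obtain ⟨a, haA, ha⟩ := exists_seq_weakTendsto_of_mem_closure hb hp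
    exact ⟨q, hA a q haA ha, rfl⟩

/-- The quadratic term is sequentially weakly lower semicontinuous because
`‖z - y‖² ≥ ‖x - y‖² + 2 ⟪x - y, z - x⟫`. -/
theorem seqWeaklyClosed_sublevel {H : Type*} [NormedAddCommGroup H] [InnerProductSpace ℝ H]
    [CompleteSpace H] {X : Set H} (hX : SeqWeaklyClosed X) {φ : X → ℝ} (hφ : SeqWeaklyLSC φ)
    (y : H) (c : ℝ) :
    SeqWeaklyClosed (Subtype.val '' {x : X | ‖(x : H) - y‖ ^ 2 + φ x ≤ c}) := by
  intro u x hu hx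
  choose v hv hvu using hu
  obtain rfl : (fun n => (v n : H)) = u := funext hvu
  have hxX : x ∈ X := hX _ x (fun n => (v n).2) hx
  refine ⟨⟨x, hxX⟩, ?_, rfl⟩
  show ‖x - y‖ ^ 2 + φ ⟨x, hxX⟩ ≤ c
  refine le_of_forall_pos_lt_add fun ε hε => ?_
  have h1 := hφ v ⟨x, hxX⟩ hx (φ ⟨x, hxX⟩ - ε / 2) (by linarith)
  have h2 : Tendsto (fun n => (2 : ℝ) * inner ℝ (x - y) ((v n : H) - x)) atTop (𝓝 0) := by
    have := ((weakTendsto_iff_inner.1 hx (x - y)).sub_const (inner ℝ (x - y) x)).const_mul 2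
    simpa [inner_sub_right] using this
  obtain ⟨n, hn1, hn2⟩ :=
    (h1.and (h2.eventually (lt_mem_nhds (show -(ε / 2) < 0 by linarith)))).exists
  have h3 : ‖(v n : H) - y‖ ^ 2 = ‖x - y‖ ^ 2 + 2 * inner ℝ (x - y) ((v n : H) - x)
      + ‖(v n : H) - x‖ ^ 2 := by
    rw [← norm_add_sq_real]; congr 2; abel
  have h4 : ‖(v n : H) - y‖ ^ 2 + φ (v n) ≤ c := hv n
  have h5 := sq_nonneg ‖(v n : H) - x‖
  linarith

/-! ### A strict minimax theorem -/

theorem exists_forall_le_of_isCompact_sublevel {T : Type*} [TopologicalSpace T] [T2Space T]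
    {G G' : T → ℝ} {c : ℝ} (hne : ∃ x, G' x ≤ c)
    (hG' : IsCompact {x | G' x ≤ c}) (hG : ∀ b, IsCompact {x | G x ≤ b}) :
    ∃ x, G' x ≤ c ∧ ∀ z, G' z ≤ c → G x ≤ G z := by
  have hlsc : LowerSemicontinuous G :=
    lowerSemicontinuous_iff_isClosed_preimage.2 fun b => (hG b).isClosed
  obtain ⟨x, hx, hmin⟩ := (hlsc.lowerSemicontinuousOn _).exists_isMinOn hne hG'
  exact ⟨x, hx, fun z hz => hmin hz⟩

theorem exists_forall_le_of_isCompact_sublevels {T : Type*} [TopologicalSpace T] [T2Space T]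
    [Nonempty T] {G : T → ℝ} (hG : ∀ b, IsCompact {x | G x ≤ b}) : ∃ x, ∀ z, G x ≤ G z := by
  obtain ⟨x₀⟩ := ‹Nonempty T›
  obtain ⟨x, hx, hmin⟩ := exists_forall_le_of_isCompact_sublevel ⟨x₀, le_rfl⟩ (hG (G x₀)) hG
  exact ⟨x, fun z => (le_total (G z) (G x₀)).elim (hmin z) hx.trans⟩

/-- Finite minimax: if every convex combination of the `F i` has a unique minimizer, then the
minimizer `x` at the weight `w` with the largest minimum `M` satisfies `F i x ≤ M` for all `i`.
Indeed, moving from `w` towards a vertex `v` by a step `t` yields minimizers `x t` at which `F v`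
is at most `M` and `F w` exceeds `M` by `O(t)`, so that `{F v ≤ M}` meets `{F w ≤ M} = {x}`. -/
theorem exists_forall_le_of_unique_min {T ι : Type*} [TopologicalSpace T] [T2Space T] [Nonempty T]
    [Fintype ι] [Nonempty ι] (F : ι → T → ℝ) (c : ℝ)
    (hcomp : ∀ w ∈ stdSimplex ℝ ι, ∀ b, IsCompact {x | ∑ i, w i * F i x ≤ b})
    (huniq : ∀ w ∈ stdSimplex ℝ ι, ∀ x x', (∀ z, ∑ i, w i * F i x ≤ ∑ i, w i * F i z) →
      (∀ z, ∑ i, w i * F i x' ≤ ∑ i, w i * F i z) → x = x')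
    (hc : ∀ w ∈ stdSimplex ℝ ι, ∃ x, ∑ i, w i * F i x ≤ c) :
    ∃ x, ∀ i, F i x ≤ c := by
  classical
  have hmin : ∀ w ∈ stdSimplex ℝ ι, ∃ x, ∀ z, ∑ i, w i * F i x ≤ ∑ i, w i * F i z :=
    fun w hw => exists_forall_le_of_isCompact_sublevels (hcomp w hw)
  choose! m hm using hmin
  obtain ⟨w, hw, hmax⟩ : ∃ w ∈ stdSimplex ℝ ι, ∀ v ∈ stdSimplex ℝ ι,
      ∑ i, v i * F i (m v) ≤ ∑ i, w i * F i (m w) := by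
    have husc : UpperSemicontinuousOn (fun w : ι → ℝ => ∑ i, w i * F i (m w))
        (stdSimplex ℝ ι) := by
      intro v hv b hb
      have hcont : Continuous fun u : ι → ℝ => ∑ i, u i * F i (m v) := by fun_prop
      filter_upwards [self_mem_nhdsWithin,
        nhdsWithin_le_nhds (hcont.continuousAt.eventually (gt_mem_nhds hb))] with u hu hub
      exact (hm u hu (m v)).trans_lt hub
    obtain ⟨w, hw, h⟩ := husc.exists_isMaxOn ⟨_, single_mem_stdSimplex ℝ (Classical.arbitrary ι)⟩
      (isCompact_stdSimplex ℝ ι)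
    exact ⟨w, hw, fun v hv => h hv⟩
  obtain ⟨M, hM⟩ : ∃ M, M = ∑ i, w i * F i (m w) := ⟨_, rfl⟩
  have hMc : M ≤ c := by
    obtain ⟨x, hx⟩ := hc w hw
    exact hM ▸ (hm w hw x).trans hx
  refine ⟨m w, fun j => ?_⟩
  have hv := single_mem_stdSimplex ℝ j
  have hsum : ∀ x, ∑ i, (Pi.single j 1 : ι → ℝ) i * F i x = F j x := fun x => by
    simp [Pi.single_apply]
  have hcompj : ∀ b, IsCompact {x | F j x ≤ b} := fun b => by
    simpa only [hsum] using hcomp _ hv b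
  have hstep : ∀ t : ℝ, 0 < t → t < 1 → ∃ x, F j x ≤ M ∧
      (1 - t) * ∑ i, w i * F i x ≤ M - t * F j (m (Pi.single j 1)) := by
    intro t ht0 ht1
    have hu := convex_stdSimplex ℝ ι hw hv (sub_nonneg.2 ht1.le) ht0.le (by ring)
    obtain ⟨u, hu'⟩ : ∃ u, u = (1 - t) • w + t • (Pi.single j 1 : ι → ℝ) := ⟨_, rfl⟩
    rw [← hu'] at hu
    have hlin : ∀ x, ∑ i, u i * F i x = (1 - t) * ∑ i, w i * F i x + t * F j x := fun x => by
      rw [← hsum x, Finset.mul_sum, Finset.mul_sum, ← Finset.sum_add_distrib]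
      refine Finset.sum_congr rfl fun i _ => ?_
      rw [hu']
      simp only [Pi.add_apply, Pi.smul_apply, smul_eq_mul]
      ring
    have h1 := hmax u hu
    rw [hlin, ← hM] at h1
    have h2 := hm w hw (m u)
    rw [← hM] at h2
    have h3 := hm _ hv (m u)
    rw [hsum, hsum] at h3
    refine ⟨m u, ?_, ?_⟩
    · have h4 : (1 - t) * M ≤ (1 - t) * ∑ i, w i * F i (m u) :=
        mul_le_mul_of_nonneg_left h2 (by linarith)
      refine le_of_mul_le_mul_left ?_ ht0
      linarith
    · have h4 := mul_le_mul_of_nonneg_left h3 ht0.le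
      linarith
  obtain ⟨x, hxj, hx⟩ := exists_forall_le_of_isCompact_sublevel
    (let ⟨x, hx, _⟩ := hstep (1 / 2) (by norm_num) (by norm_num); ⟨x, hx⟩) (hcompj M) (hcomp w hw)
  have hxM : ∑ i, w i * F i x ≤ M := by
    have key : ∀ t : ℝ, 0 < t → t < 1 →
        (1 - t) * ∑ i, w i * F i x ≤ M - t * F j (m (Pi.single j 1)) := by
      intro t h0 h1
      obtain ⟨z, hz, hz'⟩ := hstep t h0 h1
      exact (mul_le_mul_of_nonneg_left (hx z hz) (by linarith)).trans hz'
    have hlim1 : Tendsto (fun t : ℝ => (1 - t) * ∑ i, w i * F i x) (𝓝[>] 0)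
        (𝓝 ((1 - 0) * ∑ i, w i * F i x)) :=
      tendsto_nhdsWithin_of_tendsto_nhds (Continuous.tendsto (by fun_prop) 0)
    have hlim2 : Tendsto (fun t : ℝ => M - t * F j (m (Pi.single j 1))) (𝓝[>] 0)
        (𝓝 (M - 0 * F j (m (Pi.single j 1)))) :=
      tendsto_nhdsWithin_of_tendsto_nhds (Continuous.tendsto (by fun_prop) 0)
    have := le_of_tendsto_of_tendsto hlim1 hlim2 (by
      filter_upwards [Ioo_mem_nhdsGT (zero_lt_one' ℝ)] with t ht using key t ht.1 ht.2)
    simpa using this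
  have : x = m w := huniq w hw x (m w) (fun z => hxM.trans (hM ▸ hm w hw z)) (hm w hw)
  exact this ▸ hxj.trans hMc

/-- Strict minimax: let `f x y = L x y + a x` be affine in `y ∈ D` with compact sublevel sets in
`x`. If `sup_D inf f ≤ c` while every `x` has some `y ∈ D` with `c < f x y`, then some `f · y` with
`y ∈ D` has two global minimizers. By compactness finitely many `y` suffice in the second
condition, which reduces the claim to the finite minimax statement. -/
theorem exists_two_minimizers {T E : Type*} [TopologicalSpace T] [T2Space T] [Nonempty T]
    [AddCommGroup E] [Module ℝ E] {D : Set E} (hD : Convex ℝ D) (L : T → E →ₗ[ℝ] ℝ) (a : T → ℝ)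
    (c : ℝ) (hcomp : ∀ y ∈ D, ∀ b, IsCompact {x | L x y + a x ≤ b})
    (hle : ∀ y ∈ D, ∃ x, L x y + a x ≤ c) (hlt : ∀ x, ∃ y ∈ D, c < L x y + a x) :
    ∃ y ∈ D, ∃ x₁ x₂, x₁ ≠ x₂ ∧ (∀ x, L x₁ y + a x₁ ≤ L x y + a x) ∧
      (∀ x, L x₂ y + a x₂ ≤ L x y + a x) := by
  by_contra hcon
  have huniq : ∀ y ∈ D, ∀ x x', (∀ z, L x y + a x ≤ L z y + a z) →
      (∀ z, L x' y + a x' ≤ L z y + a z) → x = x' := by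
    intro y hy x x' h h'
    by_contra hne
    exact hcon ⟨y, hy, x, x', hne, h, h'⟩
  obtain ⟨x₀⟩ := ‹Nonempty T›
  obtain ⟨y₀, hy₀, -⟩ := hlt x₀
  obtain ⟨s, hs⟩ : ∃ s : Finset D, ∀ x, L x y₀ + a x ≤ c → ∃ y ∈ s, c < L x y + a x := by
    obtain ⟨s, hs⟩ := (hcomp y₀ hy₀ c).elim_finite_subcover
      (fun y : D => {x | L x y + a x ≤ c}ᶜ) (fun y => (hcomp y y.2 c).isClosed.isOpen_compl)
      (fun x _ => by
        obtain ⟨y, hy, h⟩ := hlt x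
        exact Set.mem_iUnion.2 ⟨⟨y, hy⟩, not_le.2 h⟩)
    refine ⟨s, fun x hx => ?_⟩
    obtain ⟨y, hy, h⟩ := Set.mem_iUnion₂.1 (hs hx)
    exact ⟨y, hy, not_le.1 h⟩
  classical
  let s' : Finset D := insert ⟨y₀, hy₀⟩ s
  have : Nonempty s' := ⟨⟨⟨y₀, hy₀⟩, Finset.mem_insert_self _ _⟩⟩
  have hmem : ∀ w ∈ stdSimplex ℝ s', ∑ i, w i • ((i : D) : E) ∈ D := fun w hw =>
    hD.sum_mem (fun i _ => hw.1 i) hw.2 fun i _ => i.1.2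
  have hF : ∀ w ∈ stdSimplex ℝ s', ∀ x, ∑ i, w i * (L x ((i : D) : E) + a x) =
      L x (∑ i, w i • ((i : D) : E)) + a x := by
    intro w hw x
    simp only [mul_add, Finset.sum_add_distrib, ← Finset.sum_mul, hw.2, one_mul, map_sum, map_smul,
      smul_eq_mul]
  obtain ⟨x, hx⟩ := exists_forall_le_of_unique_min
    (fun (i : s') x => L x ((i : D) : E) + a x) c
    (fun w hw b => by simpa only [hF w hw] using hcomp _ (hmem w hw) b)
    (fun w hw => by simpa only [hF w hw] using huniq _ (hmem w hw))
    (fun w hw => by simpa only [hF w hw] using hle _ (hmem w hw))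
  obtain ⟨y, hy, hlt'⟩ := hs x (hx ⟨⟨y₀, hy₀⟩, Finset.mem_insert_self _ _⟩)
  exact absurd (hx ⟨y, Finset.mem_insert_of_mem hy⟩) (not_le.2 hlt')

/-! ### The perturbed distance function -/

/-- The dense set has a suitable point near the boundary point of the ball opposite to `x`: at
`y = u₀ - s (x - u₀) / ‖x - u₀‖` the left side equals `‖x - u₀‖² + 2 s ‖x - u₀‖`. -/
theorem exists_mem_dense_lt_norm_sq_sub {H : Type*} [NormedAddCommGroup H]
    [InnerProductSpace ℝ H] {S : Set H} (hS : Dense S) {x u₀ : H} {r δ b : ℝ} (hδ : 0 < δ)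
    (hr : 0 < r) (hx : δ ≤ ‖x - u₀‖) (hb : b < δ ^ 2 + 2 * δ * r) :
    ∃ y ∈ S, ‖y - u₀‖ < r ∧ b < ‖x - y‖ ^ 2 - ‖y - u₀‖ ^ 2 := by
  obtain ⟨s, hs1, hs2⟩ : ∃ s, max 0 ((b - δ ^ 2) / (2 * δ)) < s ∧ s < r := by
    refine exists_between (max_lt hr ?_)
    rw [div_lt_iff₀ (by positivity)]
    linarith
  have hs0 : 0 < s := (le_max_left _ _).trans_lt hs1
  have hsb : b < δ ^ 2 + 2 * δ * s := by
    have := (le_max_right _ _).trans_lt hs1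
    rw [div_lt_iff₀ (by positivity)] at this
    linarith
  have hn : 0 < ‖x - u₀‖ := hδ.trans_le hx
  have hopen : IsOpen {y : H | ‖y - u₀‖ < r ∧ b < ‖x - y‖ ^ 2 - ‖y - u₀‖ ^ 2} := by
    refine IsOpen.and (isOpen_lt ?_ ?_) (isOpen_lt ?_ ?_) <;> fun_prop
  obtain ⟨y, hy, hyS⟩ := hS.inter_open_nonempty _ hopen ⟨u₀ - (s / ‖x - u₀‖) • (x - u₀), by
    have h1 : ‖u₀ - (s / ‖x - u₀‖) • (x - u₀) - u₀‖ = s := by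
      rw [sub_sub_cancel_left, norm_neg, norm_smul, norm_div, norm_norm, Real.norm_eq_abs,
        abs_of_pos hs0, div_mul_cancel₀ _ hn.ne']
    have h2 : ‖x - (u₀ - (s / ‖x - u₀‖) • (x - u₀))‖ = ‖x - u₀‖ + s := by
      have : x - (u₀ - (s / ‖x - u₀‖) • (x - u₀)) = (1 + s / ‖x - u₀‖) • (x - u₀) := by
        rw [add_smul, one_smul]; abel
      rw [this, norm_smul, Real.norm_eq_abs, abs_of_pos (by positivity)]
      field_simp
    refine ⟨by rw [h1]; exact hs2, ?_⟩
    rw [h1, h2]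
    nlinarith⟩
  exact ⟨y, hyS, hy.1, hy.2⟩

/-- The bound defining `rho`, with the point `y` of the ball around `u₀` in place of `u₀ + y`. -/
theorem infDist_sq_sub_le_rho {H : Type*} [NormedAddCommGroup H] [InnerProductSpace ℝ H]
    (X : Set H) {u₀ y : H} {r : ℝ} (hy : ‖y - u₀‖ < r) :
    Metric.infDist y X ^ 2 - ‖y - u₀‖ ^ 2 ≤ rho X u₀ r :=
  le_csSup (rho_bddAbove X u₀ r) ⟨y - u₀, hy, by simp⟩

theorem theorem1p1 {H : Type*} [NormedAddCommGroup H] [InnerProductSpace ℝ H] [CompleteSpace H]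
    (X : Set H) (hXconv : ¬ Convex ℝ X) (hXclosed : SeqWeaklyClosed X)
    (u₀ : H) (hu₀ : u₀ ∈ convexHull ℝ X \ X)
    (S : Set H) (hSconv : Convex ℝ S) (hSdense : Dense S)
    (φ : X → ℝ) (hφbdd : Bornology.IsBounded (Set.range φ)) (hφlsc : SeqWeaklyLSC φ)
    (r : ℝ) (hr : 0 < r)
    (hr' : (rho X u₀ r - Metric.infDist u₀ X ^ 2 + (⨆ x, φ x) - (⨅ x, φ x)) /
      (2 * Metric.infDist u₀ X) < r) :
    ∃ y₀ ∈ S, ‖y₀ - u₀‖ < r ∧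
      ∃ x₁ x₂ : X, x₁ ≠ x₂ ∧
        (∀ x : X, ‖(x₁ : H) - y₀‖ ^ 2 + φ x₁ ≤ ‖(x : H) - y₀‖ ^ 2 + φ x) ∧
        (∀ x : X, ‖(x₂ : H) - y₀‖ ^ 2 + φ x₂ ≤ ‖(x : H) - y₀‖ ^ 2 + φ x) := by
  have hne : X.Nonempty := convexHull_nonempty_iff.1 ⟨u₀, hu₀.1⟩
  have hδ := hXclosed.infDist_pos hne hu₀.2
  have : Nonempty X := hne.to_subtype
  have hsup : ∀ x, φ x ≤ ⨆ x, φ x := le_ciSup hφbdd.bddAbove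
  have hinf : ∀ x, ⨅ x, φ x ≤ φ x := ciInf_le hφbdd.bddBelow
  rw [div_lt_iff₀ (by positivity)] at hr'
  obtain ⟨c, hc1, hc2⟩ : ∃ c, rho X u₀ r + (⨆ x, φ x) < c ∧
      c < Metric.infDist u₀ X ^ 2 + 2 * Metric.infDist u₀ X * r + ⨅ x, φ x :=
    exists_between (by linarith)
  -- `X` carries the weak topology; `f x y = ‖x - y‖² + φ x - ‖y - u₀‖²` is affine in `y`.
  let : TopologicalSpace X :=
    TopologicalSpace.induced (fun x : X => rieszWeakDual H x) inferInstance
  have hind : Topology.IsInducing (fun x : X => rieszWeakDual H x) := ⟨rfl⟩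
  have : T2Space X := T2Space.of_injective_continuous
    ((rieszWeakDual_bijective H).1.comp Subtype.val_injective) hind.continuous
  let L : X → H →ₗ[ℝ] ℝ := fun x => innerₗ H ((2 : ℝ) • (u₀ - (x : H)))
  let a : X → ℝ := fun x => ‖(x : H)‖ ^ 2 - ‖u₀‖ ^ 2 + φ x
  have hf : ∀ (x : X) (y : H), L x y + a x = ‖(x : H) - y‖ ^ 2 + φ x - ‖y - u₀‖ ^ 2 := by
    intro x y
    simp only [L, a, innerₗ_apply_apply, inner_smul_left, inner_sub_left, norm_sub_sq_real,
      real_inner_comm u₀ y, conj_trivial]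
    ring
  have hcomp : ∀ (y : H) (b : ℝ), IsCompact {x : X | L x y + a x ≤ b} := by
    intro y b
    have hset : {x : X | L x y + a x ≤ b} =
        {x : X | ‖(x : H) - y‖ ^ 2 + φ x ≤ b + ‖y - u₀‖ ^ 2} := by
      ext x
      simp only [Set.mem_ofPred_eq, hf, sub_le_iff_le_add]
    rw [hset, hind.isCompact_iff, ← Set.image_image (rieszWeakDual H) Subtype.val]
    refine (seqWeaklyClosed_sublevel hXclosed hφlsc y _).isCompact_image ?_
    refine (Metric.isBounded_closedBall (x := y)
      (r := 1 + (b + ‖y - u₀‖ ^ 2 - ⨅ x, φ x))).subset ?_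
    rintro _ ⟨x, hx, rfl⟩
    have hx' : ‖(x : H) - y‖ ^ 2 + φ x ≤ b + ‖y - u₀‖ ^ 2 := hx
    rw [mem_closedBall_iff_norm]
    -- A real number `t` satisfies `t ≤ 1 + t²`.
    nlinarith [hinf x, sq_nonneg (‖(x : H) - y‖ - 1)]
  have hle : ∀ y ∈ S ∩ Metric.ball u₀ r, ∃ x, L x y + a x ≤ c := by
    rintro y ⟨-, hy⟩
    have h1 := infDist_sq_sub_le_rho X (mem_ball_iff_norm.1 hy)
    have h2 : Metric.infDist y X < √(c - (⨆ x, φ x) + ‖y - u₀‖ ^ 2) :=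
      Real.lt_sqrt_of_sq_lt (by linarith)
    obtain ⟨x, hx, hxy⟩ := (Metric.infDist_lt_iff hne).1 h2
    refine ⟨⟨x, hx⟩, ?_⟩
    rw [dist_comm, dist_eq_norm, Real.lt_sqrt (norm_nonneg _)] at hxy
    rw [hf]
    linarith [hsup ⟨x, hx⟩]
  have hlt : ∀ x, ∃ y ∈ S ∩ Metric.ball u₀ r, c < L x y + a x := by
    intro x
    have hx : Metric.infDist u₀ X ≤ ‖(x : H) - u₀‖ := by
      rw [← dist_eq_norm, dist_comm]
      exact Metric.infDist_le_dist_of_mem x.2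
    obtain ⟨y, hyS, hyr, hy⟩ := exists_mem_dense_lt_norm_sq_sub hSdense hδ hr hx
      (show c - ⨅ x, φ x < _ by linarith)
    refine ⟨y, ⟨hyS, mem_ball_iff_norm.2 hyr⟩, ?_⟩
    rw [hf]
    linarith [hinf x]
  obtain ⟨y, ⟨hyS, hyr⟩, x₁, x₂, hne', h₁, h₂⟩ := exists_two_minimizers
    (D := S ∩ Metric.ball u₀ r) (hSconv.inter (convex_ball u₀ r)) L a c
    (fun y _ => hcomp y) hle hlt
  refine ⟨y, hyS, mem_ball_iff_norm.1 hyr, x₁, x₂, hne', fun x => ?_, fun x => ?_⟩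
  · have := h₁ x
    rw [hf, hf] at this
    linarith
  · have := h₂ x
    rw [hf, hf] at this
    linarith
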